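/- Let $(X,\tau)$ be a real Hausdorff locally convex space with topological dual $X^*$, endowed with the weak-star topology $w^*$; write $\langle x,x^*\rangle=x^*(x)$ and $c(x,x^*)=\langle x,x^*\rangle$ for $(x,x^*)\in X\times X^*$. For $f:X\times X^*\to[-\infty,+\infty]$ put $$f^{\square}(x,x^*)=\sup\{\langle x,u^*\rangle+\langle u,x^*\rangle-f(u,u^*)\mid (u,u^*)\in X\times X^*\}.$$ A multi-valued operator $T:X\rightrightarrows X^*$ has domain $D(T)=\{x\mid Tx\neq\emptyset\}$. A representative of $T$ is a proper convex $\tau\times w^*$-lower semicontinuous function $h:X\times X^*\to(-\infty,+\infty]$ such that $h\ge c$ on $X\times X^*$ and $\{z\mid h(z)=c(z)\}=\operatorname{Graph}T$. The operator $T$ is called representable if $D(T)\neq\emptyset$ and $T$ has a representative. The Fitzpatrick function of $T$ is $$\varphi_T(x,x^*)=\sup\{\langle x,u^*\rangle+\langle u,x^*\rangle-\langle u,u^*\rangle\mid (u,u^*)\in\operatorname{Graph}T\}.$$ For $C\subset X$ let $\iota_C$ be the indicator function of $C$ ($0$ on $C$ and $+\infty$ outside $C$), $\sigma_C(x^*)=\sup_{x\in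 C}\langle x,x^*\rangle$ its support function, and $N_C=\partial\iota_C$ its normal cone operator. Theorem. Let $A:X\rightrightarrows X^*$ be representable and let $C\subset X$ be closed and convex. If $D(A)\cap\operatorname{int}C\neq\emptyset$, then $A+N_C$ is representable. Moreover, with $$\rho(x,x^*)=\inf\{\varphi_A(x,x_1^*)+\iota_C(x)+\sigma_C(x_2^*)\mid x_1^*,x_2^*\in X^*,\ x_1^*+x_2^*=x^*\},$$ the function $\rho^{\square}$ is a representative of $A+N_C$. -/

import Mathlib

noncomputable section

namespace LCSMonotone

/-- The indicator function of a set: `0` on the set and `+∞` outside it. -/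
def indicator {E : Type*} (S : Set E) : E → EReal :=
  open Classical in fun x => if x ∈ S then 0 else ⊤

/-- A proper extended-real function: it is not identically `+∞` and never takes the value `-∞`. -/
def IsProper {E : Type*} (f : E → EReal) : Prop :=
  (∃ x, f x ≠ ⊤) ∧ ∀ x, f x ≠ ⊥

/-- A convex extended-real function: its epigraph, as a subset of `E × ℝ`, is convex. -/
def IsConvexFn {E : Type*} [AddCommGroup E] [Module ℝ E] (f : E → EReal) : Prop :=
  Convex ℝ {p : E × ℝ | f p.1 ≤ (p.2 : EReal)}

variable {X : Type*} [AddCommGroup X] [Module ℝ X] [TopologicalSpace X]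

/-- The graph of a multi-valued operator from `X` to its topological dual. The dual carries the
weak-star topology, so `X × WeakDual ℝ X` carries the product of the topology of `X` and the
weak-star topology. -/
def graph (T : X → Set (WeakDual ℝ X)) : Set (X × WeakDual ℝ X) :=
  {z | z.2 ∈ T z.1}

/-- The domain of a multi-valued operator. -/
def domain (T : X → Set (WeakDual ℝ X)) : Set X :=
  {x | (T x).Nonempty}

/-- The pointwise sum of two multi-valued operators. -/
def opAdd [ContinuousAdd X] (A B : X → Set (WeakDual ℝ X)) : X → Set (WeakDual ℝ X) :=
  fun x => {y | ∃ a ∈ A x, ∃ b ∈ B x, a + b = y}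

/-- The duality product `c (x, x*) = ⟨x, x*⟩`. -/
def coupling (z : X × WeakDual ℝ X) : ℝ := z.2 z.1

/-- The natural pairing of `X × X*` with itself: `z · w = ⟨x, u*⟩ + ⟨u, x*⟩` for `z = (x, x*)` and
`w = (u, u*)`. -/
def natPairing (z w : X × WeakDual ℝ X) : ℝ := w.2 z.1 + z.2 w.1

/-- The conjugate of a function on `X × X*` for the natural pairing of `X × X*` with itself. -/
def conj (f : X × WeakDual ℝ X → EReal) : X × WeakDual ℝ X → EReal :=
  fun z => ⨆ w, ((natPairing z w : ℝ) : EReal) - f w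

/-- The Fitzpatrick function of `T`: the conjugate of the duality product restricted to the graph
of `T` (that is, of the duality product plus the indicator of the graph). -/
def fitzpatrick (T : X → Set (WeakDual ℝ X)) : X × WeakDual ℝ X → EReal :=
  conj fun z => ((coupling z : ℝ) : EReal) + indicator (graph T) z

/-- The support function of a subset of `X`, as a function on the dual. -/
def support (C : Set X) : WeakDual ℝ X → EReal :=
  fun y => ⨆ x ∈ C, ((y x : ℝ) : EReal)

/-- The function `(x, x*) ↦ ι_C x + σ_C x*`. -/
def indicatorSupport (C : Set X) : X × WeakDual ℝ X → EReal :=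
  fun z => indicator C z.1 + support C z.2

/-- The infimal convolution of two functions on `X × X*` with respect to the dual variable. -/
def dualConvolution [ContinuousAdd X] (f g : X × WeakDual ℝ X → EReal) :
    X × WeakDual ℝ X → EReal :=
  fun z => ⨅ (y₁ : WeakDual ℝ X) (y₂ : WeakDual ℝ X) (_ : y₁ + y₂ = z.2),
    f (z.1, y₁) + g (z.1, y₂)

/-- The subdifferential of an extended-real function on `X`; it is empty where the function is
`+∞`. -/
def subdifferential (f : X → EReal) (x : X) : Set (WeakDual ℝ X) :=
  {y | f x ≠ ⊤ ∧ ∀ u, ((y (u - x) : ℝ) : EReal) + f x ≤ f u}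

/-- The normal cone operator of `C`: the subdifferential of the indicator function of `C`. -/
def normalCone (C : Set X) : X → Set (WeakDual ℝ X) :=
  subdifferential (indicator C)

theorem mem_normalCone {C : Set X} {x : X} {y : WeakDual ℝ X} :
    y ∈ normalCone C x ↔ x ∈ C ∧ ∀ u ∈ C, y (u - x) ≤ 0 := by
  unfold normalCone subdifferential indicator
  by_cases hx : x ∈ C
  · simp only [Set.mem_ofPred_eq, hx, if_true, add_zero, true_and]
    constructor
    · rintro ⟨-, h⟩ u hu
      have := h u
      rw [if_pos hu] at this
      exact_mod_cast this
    · intro h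
      refine ⟨by simp, fun u => ?_⟩
      by_cases hu : u ∈ C
      · rw [if_pos hu]
        exact_mod_cast h u hu
      · rw [if_neg hu]
        exact le_top
  · simp [hx]

/-- `h` is a representative of `T`: it is a proper convex function on `X × X*`, lower
semicontinuous for the product of the topology of `X` and the weak-star topology, it majorizes the
duality product, and it equals the duality product exactly on the graph of `T`. -/
structure IsRepresentative (h : X × WeakDual ℝ X → EReal) (T : X → Set (WeakDual ℝ X)) :
    Prop where
  proper : IsProper h
  convex : IsConvexFn h
  lsc : LowerSemicontinuous h
  coupling_le : ∀ z, ((coupling z : ℝ) : EReal) ≤ h z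
  eq_iff : ∀ z, h z = ((coupling z : ℝ) : EReal) ↔ z ∈ graph T

/-- An operator is representable if its domain is nonempty and it has a representative. -/
def IsRepresentable (T : X → Set (WeakDual ℝ X)) : Prop :=
  (domain T).Nonempty ∧ ∃ h, IsRepresentative h T

end LCSMonotone

end

namespace LCSMonotone

open Set

/-! Everything rests on a qualified sum rule: since some point of `D(A)` is interior to `C`, a bound
`ρ^□ (x, x*) ≤ r` yields `x ∈ C` and a splitting `x* = y₁ + y₂` with `σ_C y₂ ≤ α` and `φ_A^□ (x, y₁)
≤ r - α` (`fst_mem_of_conj_dualConvolution_le`, `exists_conj_le_of_conj_dualConvolution_le`). Any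
representative `h` of `A` lies below `φ_A^□` (`IsRepresentative.le_conj_fitzpatrick`), so `⟨x, y₁⟩ ≤
h (x, y₁) ≤ r - α`. Adding `⟨x, y₂⟩ ≤ α` gives `c ≤ ρ^□`. Equality makes both estimates tight: `h =
c` at `(x, y₁)` puts `y₁` in `A x`, and `y₂` attains its support value at `x`, so `y₂ ∈ N_C x`. The
converse is a direct estimate; convexity and semicontinuity hold for every conjugate. -/

theorem coe_le_of_forall_real_ge {a : ℝ} {e : EReal} (h : ∀ t : ℝ, e ≤ t → a ≤ t) :
    (a : EReal) ≤ e := by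
  by_contra! hlt
  obtain ⟨t, h1, h2⟩ := EReal.lt_iff_exists_real_btwn.1 hlt
  have := h t h1.le
  have h3 : t < a := by exact_mod_cast h2
  linarith

/-! ### Affine minorants of convex lower semicontinuous functions -/

section Affine

theorem isClosed_real_epigraph {E : Type*} [TopologicalSpace E] {f : E → EReal} (hf : LowerSemicontinuous f) :
    IsClosed {p : E × ℝ | f p.1 ≤ (p.2 : EReal)} :=
  hf.isClosed_epigraph.preimage
    (continuous_fst.prodMk (continuous_coe_real_ereal.comp continuous_snd))

variable {E : Type*} [AddCommGroup E] [Module ℝ E] [TopologicalSpace E]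

theorem clm_prod_real_apply (F : StrongDual ℝ (E × ℝ)) (x : E) (t : ℝ) :
    F (x, t) = F (x, 0) + F (0, 1) * t := by
  have : ((x, t) : E × ℝ) = (x, 0) + t • (0, 1) := by ext <;> simp
  rw [this, map_add, map_smul, smul_eq_mul, mul_comm]

variable [IsTopologicalAddGroup E] [ContinuousSMul ℝ E] [LocallyConvexSpace ℝ E]

/-- A point strictly below the graph of a convex lower semicontinuous function is strictly
separated from the epigraph by a hyperplane, possibly a vertical one. -/
theorem exists_separation_epigraph {f : E → EReal} (hp : IsProper f) (hc : IsConvexFn f)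
    (hl : LowerSemicontinuous f) {x₀ : E} {r : ℝ} (hr : (r : EReal) < f x₀) :
    ∃ (g : StrongDual ℝ E) (s u : ℝ), 0 ≤ s ∧ g x₀ + s * r < u ∧
      ∀ (x : E) (t : ℝ), f x ≤ t → u < g x + s * t := by
  obtain ⟨F, u, h1, h2⟩ := geometric_hahn_banach_point_closed (x := ((x₀, r) : E × ℝ)) hc
    (isClosed_real_epigraph hl) (by simpa using hr)
  have h2' : ∀ (x : E) (t : ℝ), f x ≤ t → u < F (x, 0) + F (0, 1) * t := fun x t hxt => by
    rw [← clm_prod_real_apply]; exact h2 (x, t) hxt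
  refine ⟨F.comp (ContinuousLinearMap.inl ℝ E ℝ), F (0, 1), u, ?_, ?_, ?_⟩
  · obtain ⟨x₁, hx₁⟩ := hp.1
    obtain ⟨t₁, ht₁, -⟩ := EReal.lt_iff_exists_real_btwn.1 (lt_top_iff_ne_top.2 hx₁)
    by_contra! hs
    have ha := h2' x₁ (max t₁ ((u - F (x₁, 0)) / F (0, 1)))
      (ht₁.le.trans (by exact_mod_cast le_max_left _ _))
    have hb := mul_le_mul_of_nonpos_left (le_max_right t₁ ((u - F (x₁, 0)) / F (0, 1))) hs.le
    rw [mul_div_cancel₀ _ hs.ne] at hb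
    linarith
  · rw [clm_prod_real_apply] at h1
    simpa using h1
  · simpa using h2'

/-- A proper convex lower semicontinuous function is the supremum of its continuous affine
minorants. -/
theorem exists_affine_minorant_gt {f : E → EReal} (hp : IsProper f) (hc : IsConvexFn f)
    (hl : LowerSemicontinuous f) {x₀ : E} {r : ℝ} (hr : (r : EReal) < f x₀) :
    ∃ (g : StrongDual ℝ E) (b : ℝ), (∀ (x : E) (t : ℝ), f x ≤ t → g x + b ≤ t) ∧
      r < g x₀ + b := by
  have nonvertical : ∀ (y₀ : E) (q : ℝ) (g : StrongDual ℝ E) (s u : ℝ), 0 < s →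
      g y₀ + s * q < u → (∀ (x : E) (t : ℝ), f x ≤ t → u < g x + s * t) →
      ∃ (g : StrongDual ℝ E) (b : ℝ), (∀ (x : E) (t : ℝ), f x ≤ t → g x + b ≤ t) ∧
        q < g y₀ + b := by
    intro y₀ q g s u hs h1 h2
    have key : ∀ x, (-(s⁻¹ • g)) x + s⁻¹ * u = (u - g x) / s := fun x => by
      simp; field_simp; ring
    refine ⟨-(s⁻¹ • g), s⁻¹ * u, fun x t hxt => ?_, ?_⟩
    · rw [key, div_le_iff₀ hs]; linarith [h2 x t hxt]
    · rw [key, lt_div_iff₀ hs]; linarith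
  obtain ⟨g, s, u, hs, h1, h2⟩ := exists_separation_epigraph hp hc hl hr
  rcases hs.lt_or_eq with hs | rfl
  · exact nonvertical x₀ r g s u hs h1 h2
  -- The hyperplane is vertical: `u - g` is negative on the effective domain and positive at `x₀`. A
  -- large multiple of it is added to a minorant built at a point where `f` is finite.
  obtain ⟨x₁, hx₁⟩ := hp.1
  obtain ⟨t₁, ht₁, -⟩ := EReal.lt_iff_exists_real_btwn.1 (lt_top_iff_ne_top.2 hx₁)
  obtain ⟨r₁, -, hr₁⟩ := EReal.lt_iff_exists_real_btwn.1 (bot_lt_iff_ne_bot.2 (hp.2 x₁))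
  obtain ⟨g', s', u', hs', h1', h2'⟩ := exists_separation_epigraph hp hc hl hr₁
  have hs'0 : 0 < s' := by
    have hlt : r₁ < t₁ := by exact_mod_cast hr₁.trans ht₁
    have := h2' x₁ t₁ ht₁.le
    nlinarith
  obtain ⟨g₁, b₁, hg₁, -⟩ := nonvertical x₁ r₁ g' s' u' hs'0 h1' h2'
  have hd : 0 < u - g x₀ := by linarith
  obtain ⟨k, hk⟩ := exists_nat_gt ((r - g₁ x₀ - b₁) / (u - g x₀))
  rw [div_lt_iff₀ hd] at hk
  have key : ∀ x, (g₁ - (k : ℝ) • g) x + (b₁ + k * u) = g₁ x + b₁ + k * (u - g x) := fun x => by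
    simp; ring
  refine ⟨g₁ - (k : ℝ) • g, b₁ + k * u, fun x t hxt => ?_, ?_⟩
  · have ha := hg₁ x t hxt
    have hb := h2 x t hxt
    have hk0 : (0 : ℝ) ≤ k := k.cast_nonneg
    rw [key]
    nlinarith
  · rw [key]; linarith

end Affine

/-! ### Conjugates for the natural pairing -/

variable {X : Type*} [AddCommGroup X] [Module ℝ X] [TopologicalSpace X]

@[simp]
theorem weakDual_add_apply [ContinuousAdd X] (y₁ y₂ : WeakDual ℝ X) (x : X) :
    (y₁ + y₂) x = y₁ x + y₂ x := rfl

@[simp]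
theorem weakDual_smul_apply (a : ℝ) (y : WeakDual ℝ X) (x : X) : (a • y) x = a * y x := rfl

@[simp]
theorem weakDual_zero_apply (x : X) : (0 : WeakDual ℝ X) x = 0 := rfl

/-- Testing against real upper bounds `t` of `f w` removes extended subtraction: a value `⊤` imposes
nothing, a value `⊥` is contradictory. -/
theorem conj_le_coe_iff {f : X × WeakDual ℝ X → EReal} {z : X × WeakDual ℝ X} {r : ℝ} :
    conj f z ≤ r ↔ ∀ (w : X × WeakDual ℝ X) (t : ℝ), f w ≤ t → natPairing z w ≤ r + t := by
  unfold conj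
  rw [iSup_le_iff]
  refine forall_congr' fun w => ?_
  induction f w with
  | bot =>
    simp only [EReal.coe_sub_bot, top_le_iff, EReal.coe_ne_top, bot_le, forall_const, false_iff]
    intro h
    linarith [h (natPairing z w - r - 1)]
  | top => simp
  | coe a =>
    norm_cast
    exact ⟨fun h t ht => by linarith, fun h => by linarith [h a le_rfl]⟩

theorem fitzpatrick_le_coe_iff {T : X → Set (WeakDual ℝ X)} {z : X × WeakDual ℝ X} {r : ℝ} :
    fitzpatrick T z ≤ r ↔ ∀ w ∈ graph T, natPairing z w ≤ r + coupling w := by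
  unfold fitzpatrick
  rw [conj_le_coe_iff]
  refine forall_congr' fun w => ?_
  by_cases hw : w ∈ graph T
  · simp only [indicator, hw, if_true, add_zero, forall_const, EReal.coe_le_coe_iff]
    exact ⟨fun h => h _ le_rfl, fun h t ht => by linarith⟩
  · simp [indicator, hw]

theorem natPairing_combo [ContinuousAdd X] (a b : ℝ) (z z' w : X × WeakDual ℝ X) :
    natPairing (a • z + b • z') w = a * natPairing z w + b * natPairing z' w := by
  simp [natPairing]; ring

theorem isConvexFn_conj [ContinuousAdd X] (f : X × WeakDual ℝ X → EReal) :
    IsConvexFn (conj f) := by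
  intro p hp q hq a b ha hb hab
  simp only [mem_ofPred_eq] at hp hq ⊢
  rw [conj_le_coe_iff] at hp hq ⊢
  intro w t hw
  have h1 := mul_le_mul_of_nonneg_left (hp w t hw) ha
  have h2 := mul_le_mul_of_nonneg_left (hq w t hw) hb
  have h3 : t = a * t + b * t := by rw [← add_mul, hab, one_mul]
  simp only [Prod.fst_add, Prod.snd_add, Prod.smul_fst, Prod.smul_snd, smul_eq_mul,
    natPairing_combo]
  linarith

theorem continuous_natPairing (w : X × WeakDual ℝ X) : Continuous fun z => natPairing z w :=
  (w.2.continuous.comp continuous_fst).add ((WeakDual.eval_continuous w.1).comp continuous_snd)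

theorem lowerSemicontinuous_conj (f : X × WeakDual ℝ X → EReal) :
    LowerSemicontinuous (conj f) := by
  refine lowerSemicontinuous_iSup fun w => Continuous.lowerSemicontinuous ?_
  induction f w with
  | bot => simpa using continuous_const
  | top => simpa using continuous_const
  | coe a =>
    exact continuous_coe_real_ereal.comp ((continuous_natPairing w).sub continuous_const)

/-- Weak-star continuous functionals on the dual are evaluations at points of `X`, so affine
minorants on `X × X*` are governed by the natural pairing. -/
theorem exists_eq_natPairing [IsTopologicalAddGroup X] [ContinuousSMul ℝ X]
    (g : StrongDual ℝ (X × WeakDual ℝ X)) :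
    ∃ p : X × WeakDual ℝ X, ∀ z, g z = natPairing z p := by
  obtain ⟨x, hx⟩ := LinearMap.dualEmbedding_surjective (topDualPairing ℝ X)
    (g.comp (ContinuousLinearMap.inr ℝ X (WeakDual ℝ X)))
  refine ⟨(x, StrongDual.toWeakDual (g.comp (ContinuousLinearMap.inl ℝ X (WeakDual ℝ X)))),
    fun z => ?_⟩
  have h1 : z.2 x = g (0, z.2) := DFunLike.congr_fun hx z.2
  have h2 : z = (z.1, 0) + (0, z.2) := by ext <;> simp
  conv_lhs => rw [h2, map_add]
  simp [natPairing, h1]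

section Representable

variable {A : X → Set (WeakDual ℝ X)} {h : X × WeakDual ℝ X → EReal}

/-- The graph of a representable operator is monotone. -/
theorem IsRepresentative.natPairing_le [ContinuousAdd X] (hh : IsRepresentative h A)
    {z w : X × WeakDual ℝ X} (hz : z ∈ graph A) (hw : w ∈ graph A) :
    natPairing z w ≤ coupling z + coupling w := by
  -- The inequality `c ≤ h` at the midpoint of two graph points rearranges to monotonicity.
  have hmid := hh.convex (x := (z, coupling z)) ((hh.eq_iff z).2 hz).le
    (y := (w, coupling w)) ((hh.eq_iff w).2 hw).le (a := 1 / 2) (b := 1 / 2)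
    (by norm_num) (by norm_num) (by norm_num)
  have hle := (hh.coupling_le _).trans hmid
  simp only [Prod.fst_add, Prod.snd_add, Prod.smul_fst, Prod.smul_snd, smul_eq_mul,
    EReal.coe_le_coe_iff, coupling, weakDual_add_apply, weakDual_smul_apply, map_add,
    map_smul] at hle
  simp only [natPairing, coupling]
  linarith

theorem IsRepresentative.fitzpatrick_le [ContinuousAdd X] (hh : IsRepresentative h A)
    {z : X × WeakDual ℝ X} (hz : z ∈ graph A) : fitzpatrick A z ≤ (coupling z : ℝ) :=
  fitzpatrick_le_coe_iff.2 fun _ hw => hh.natPairing_le hz hw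

/-- Every representative of an operator is majorized by the conjugate of its Fitzpatrick
function. -/
theorem IsRepresentative.le_conj_fitzpatrick [IsTopologicalAddGroup X] [ContinuousSMul ℝ X]
    [LocallyConvexSpace ℝ X] (hh : IsRepresentative h A) (z : X × WeakDual ℝ X) :
    h z ≤ conj (fitzpatrick A) z := by
  have : IsTopologicalAddGroup (WeakDual ℝ X) :=
    inferInstanceAs (IsTopologicalAddGroup (WeakBilin (topDualPairing ℝ X)))
  have : LocallyConvexSpace ℝ (WeakDual ℝ X) :=
    inferInstanceAs (LocallyConvexSpace ℝ (WeakBilin (topDualPairing ℝ X)))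
  by_contra! hlt
  obtain ⟨r, hr₁, hr₂⟩ := EReal.lt_iff_exists_real_btwn.1 hlt
  obtain ⟨g, b, hg, hgz⟩ := exists_affine_minorant_gt hh.proper hh.convex hh.lsc hr₂
  obtain ⟨p, hp⟩ := exists_eq_natPairing g
  have hφ : fitzpatrick A p ≤ ((-b : ℝ) : EReal) := by
    refine fitzpatrick_le_coe_iff.2 fun w hw => ?_
    have := hg w (coupling w) ((hh.eq_iff w).2 hw).le
    rw [hp] at this
    simp only [natPairing] at this ⊢
    linarith
  have := conj_le_coe_iff.1 hr₁.le p (-b) hφ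
  rw [hp] at hgz
  linarith

end Representable

theorem dualConvolution_le [ContinuousAdd X] {f : X × WeakDual ℝ X → EReal} {C : Set X} {u : X}
    {y₁ y₂ : WeakDual ℝ X} {t s : ℝ} (hf : f (u, y₁) ≤ t) (hu : u ∈ C)
    (hs : ∀ v ∈ C, y₂ v ≤ s) :
    dualConvolution f (indicatorSupport C) (u, y₁ + y₂) ≤ ((t + s : ℝ) : EReal) := by
  refine (iInf_le_of_le y₁ <| iInf_le_of_le y₂ <| iInf_le _ rfl).trans ?_
  rw [EReal.coe_add]
  refine add_le_add hf ?_
  simp only [indicatorSupport, indicator, hu, if_true, zero_add, support]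
  exact iSup₂_le fun v hv => by exact_mod_cast hs v hv

/-! ### Conjugate sum rule -/

section SumRule

variable [IsTopologicalAddGroup X] [ContinuousSMul ℝ X]
  {f : X × WeakDual ℝ X → EReal} {C : Set X} {z : X × WeakDual ℝ X} {r : ℝ}

/-- Outside `C`, adding multiples `k • g` of a separating functional costs at most `k * u` in the
support term but gains `k * g z.1`, which breaks any bound `r`. -/
theorem fst_mem_of_conj_dualConvolution_le [LocallyConvexSpace ℝ X] (hC : IsClosed C) (hCc : Convex ℝ C)
    {x₀ : X} {y₀ : WeakDual ℝ X} {t₀ : ℝ} (hx₀ : x₀ ∈ C) (hf₀ : f (x₀, y₀) ≤ t₀)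
    (hz : conj (dualConvolution f (indicatorSupport C)) z ≤ r) : z.1 ∈ C := by
  by_contra hzC
  obtain ⟨g, u, hgC, hgz⟩ := geometric_hahn_banach_closed_point hCc hC hzC
  have hd : 0 < g z.1 - u := by linarith
  obtain ⟨k, hk⟩ := exists_nat_gt ((r + t₀ - y₀ z.1 - z.2 x₀) / (g z.1 - u))
  rw [div_lt_iff₀ hd] at hk
  have h1 := conj_le_coe_iff.1 hz _ _ (dualConvolution_le (y₂ := (k : ℝ) • StrongDual.toWeakDual g)
    (s := k * u) hf₀ hx₀ fun v hv => mul_le_mul_of_nonneg_left (hgC v hv).le k.cast_nonneg)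
  simp only [natPairing, weakDual_add_apply, weakDual_smul_apply,
    StrongDual.toWeakDual_apply] at h1
  linarith

/-- The conjugate sum rule for a convex function and the indicator function of a convex set whose
interior meets the domain of the function, with exact infimal convolution. -/
theorem exists_conj_le_of_conj_dualConvolution_le (hf : IsConvexFn f) (hCc : Convex ℝ C)
    {x₀ : X} {y₀ : WeakDual ℝ X} {t₀ : ℝ} (hx₀ : x₀ ∈ interior C) (hf₀ : f (x₀, y₀) ≤ t₀)
    (hz : conj (dualConvolution f (indicatorSupport C)) z ≤ r) :
    ∃ (y₁ y₂ : WeakDual ℝ X) (α : ℝ), y₁ + y₂ = z.2 ∧ (∀ u ∈ C, y₂ u ≤ α) ∧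
      conj f (z.1, y₁) ≤ ((r - α : ℝ) : EReal) := by
  -- Projecting out `y` leaves a convex set over `X`; the bound on the conjugate keeps it off the
  -- open set `interior C ×ˢ Iio 0`.
  let S : Set (X × ℝ) :=
    {p | ∃ y : WeakDual ℝ X, f (p.1, y) ≤ ((p.2 + y z.1 + z.2 p.1 - r : ℝ) : EReal)}
  have hS : Convex ℝ S := by
    rintro p ⟨y, hy⟩ q ⟨y', hy'⟩ a b ha hb hab
    refine ⟨a • y + b • y', ?_⟩
    have := hf (x := ((p.1, y), _)) hy (y := ((q.1, y'), _)) hy' ha hb hab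
    refine le_of_le_of_eq this ?_
    have hr : r = a * r + b * r := by rw [← add_mul, hab, one_mul]
    norm_cast
    simp only [Prod.fst_add, Prod.snd_add, Prod.smul_fst, Prod.smul_snd, smul_eq_mul,
      weakDual_add_apply, weakDual_smul_apply, map_add, map_smul]
    linear_combination hr
  have hdisj : Disjoint (interior C ×ˢ Iio (0 : ℝ)) S := by
    rw [Set.disjoint_left]
    rintro ⟨u, t⟩ ⟨hu, ht⟩ ⟨y, hy⟩
    have h1 := conj_le_coe_iff.1 hz _ _ (dualConvolution_le (y₂ := 0) (s := 0) hy
      (interior_subset hu) fun v _ => le_rfl)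
    simp only [natPairing, weakDual_add_apply, weakDual_zero_apply] at h1
    simp only [mem_Iio] at ht
    linarith
  obtain ⟨F, β, hF₁, hF₂⟩ := geometric_hahn_banach_open
    (hCc.interior.prod (convex_Iio (0 : ℝ))) (isOpen_interior.prod isOpen_Iio) hS hdisj
  have hF₁' : ∀ u ∈ interior C, ∀ t < 0, F (u, 0) + F (0, 1) * t < β := fun u hu t ht => by
    rw [← clm_prod_real_apply]; exact hF₁ (u, t) ⟨hu, ht⟩
  have hF₂' : ∀ (u : X) (y : WeakDual ℝ X) (t : ℝ), f (u, y) ≤ t →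
      β ≤ F (u, 0) + F (0, 1) * (t - y z.1 - z.2 u + r) := fun u y t hy => by
    rw [← clm_prod_real_apply]
    refine hF₂ _ ⟨y, ?_⟩
    convert! hy using 2
    ring
  -- The qualification condition excludes a vertical hyperplane: both separated sets have points
  -- above `x₀`.
  have hs : 0 < F (0, 1) := by
    by_contra! hs
    set τ : ℝ := t₀ - y₀ z.1 - z.2 x₀ + r
    have h1 := hF₁' x₀ hx₀ (-(|τ| + 1)) (by linarith [abs_nonneg τ])
    have h2 := hF₂' x₀ y₀ t₀ hf₀
    have h3 : -(|τ| + 1) ≤ τ := by linarith [neg_abs_le τ]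
    nlinarith [mul_le_mul_of_nonpos_left h3 hs]
  set s := F (0, 1)
  have hCF : ∀ u ∈ C, F (u, 0) ≤ β := by
    have hint : ∀ u ∈ interior C, F (u, 0) ≤ β := fun u hu => by
      refine le_of_forall_pos_le_add fun ε hε => ?_
      have := hF₁' u hu (-(ε / s)) (by have := div_pos hε hs; linarith)
      rw [mul_neg, mul_div_cancel₀ _ hs.ne'] at this
      linarith
    intro u hu
    have hcl : u ∈ closure (interior C) := by
      rw [hCc.closure_interior_eq_closure_of_nonempty_interior ⟨x₀, hx₀⟩]
      exact subset_closure hu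
    have hclosed : IsClosed {v : X | F (v, 0) ≤ β} :=
      isClosed_le (by fun_prop) continuous_const
    exact closure_minimal hint hclosed hcl
  let g : WeakDual ℝ X :=
    StrongDual.toWeakDual (s⁻¹ • F.comp (ContinuousLinearMap.inl ℝ X ℝ))
  have hg : ∀ u, g u = F (u, 0) / s := fun u => by
    simp [g, div_eq_inv_mul]
  -- The normalized slope of the hyperplane is the part of `z.2` carried by `C`, and its normalized
  -- level bounds the support function there.
  refine ⟨z.2 - g, g, β / s, sub_add_cancel _ _, fun u hu => ?_, ?_⟩
  · rw [hg]
    exact div_le_div_of_nonneg_right (hCF u hu) hs.le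
  · refine conj_le_coe_iff.2 fun w t hw => ?_
    have h1 := div_le_div_of_nonneg_right (hF₂' w.1 w.2 t hw) hs.le
    rw [add_div, mul_div_cancel_left₀ _ hs.ne', ← hg] at h1
    have h2 : (z.2 - g) w.1 = z.2 w.1 - g w.1 := rfl
    simp only [natPairing, h2]
    linarith

end SumRule

/-! ### The operator sum and its representative -/

section NormalCone

variable [ContinuousAdd X] {A : X → Set (WeakDual ℝ X)} {C : Set X} {z : X × WeakDual ℝ X}

theorem conj_dualConvolution_le_coupling
    (hz : z ∈ graph (opAdd A (normalCone C))) :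
    conj (dualConvolution (fitzpatrick A) (indicatorSupport C)) z ≤ (coupling z : ℝ) := by
  obtain ⟨a, ha, b, hb, hab⟩ := hz
  rw [mem_normalCone] at hb
  obtain ⟨hzC, hb⟩ := hb
  refine conj_le_coe_iff.2 fun w t hw => ?_
  have key : ((natPairing z w - coupling z : ℝ) : EReal) ≤
      dualConvolution (fitzpatrick A) (indicatorSupport C) w := by
    refine le_iInf fun y₁ => le_iInf fun y₂ => le_iInf fun hy => ?_
    -- Each supremum is tested at one point: `φ_A` at `(z.1, a)` and `σ_C` at `z.1`; the normal cone
    -- inequality for `b` absorbs the remainder.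
    have h1 : ((natPairing (w.1, y₁) (z.1, a) - coupling (z.1, a) : ℝ) : EReal) ≤
        fitzpatrick A (w.1, y₁) := coe_le_of_forall_real_ge fun t ht => by
      linarith [fitzpatrick_le_coe_iff.1 ht (z.1, a) ha]
    have h2 : ((y₂ z.1 : ℝ) : EReal) ≤ support C y₂ :=
      le_iSup₂_of_le (f := fun x (_ : x ∈ C) => ((y₂ x : ℝ) : EReal)) z.1 hzC le_rfl
    by_cases hu : w.1 ∈ C
    · have h3 : indicatorSupport C (w.1, y₂) = support C y₂ := by
        simp [indicatorSupport, indicator, hu]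
      rw [h3]
      refine le_trans ?_ (add_le_add h1 h2)
      have h4 := hb w.1 hu
      rw [map_sub] at h4
      norm_cast
      simp only [natPairing, coupling, ← hab, ← hy, weakDual_add_apply]
      linarith
    · have h3 : indicatorSupport C (w.1, y₂) = ⊤ := by
        simp only [indicatorSupport, indicator, hu, if_false]
        exact EReal.top_add_of_ne_bot (ne_bot_of_le_ne_bot (EReal.coe_ne_bot _) h2)
      rw [h3, EReal.add_top_of_ne_bot (ne_bot_of_le_ne_bot (EReal.coe_ne_bot _) h1)]
      exact le_top
  have : natPairing z w - coupling z ≤ t := by exact_mod_cast key.trans hw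
  linarith

end NormalCone

theorem isRepresentative_conj_dualConvolution [IsTopologicalAddGroup X] [ContinuousSMul ℝ X]
    [LocallyConvexSpace ℝ X] {A : X → Set (WeakDual ℝ X)} {h : X × WeakDual ℝ X → EReal}
    (hh : IsRepresentative h A) {C : Set X} (hC : IsClosed C) (hCc : Convex ℝ C)
    {x₀ : X} {y₀ : WeakDual ℝ X} (hy₀ : y₀ ∈ A x₀) (hx₀ : x₀ ∈ interior C) :
    IsRepresentative (conj (dualConvolution (fitzpatrick A) (indicatorSupport C)))
      (opAdd A (normalCone C)) := by
  have hf₀ : fitzpatrick A (x₀, y₀) ≤ (coupling (x₀, y₀) : ℝ) := hh.fitzpatrick_le hy₀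
  have split : ∀ {z : X × WeakDual ℝ X} {r : ℝ},
      conj (dualConvolution (fitzpatrick A) (indicatorSupport C)) z ≤ r →
      z.1 ∈ C ∧ ∃ (y₁ y₂ : WeakDual ℝ X) (α : ℝ), y₁ + y₂ = z.2 ∧ (∀ u ∈ C, y₂ u ≤ α) ∧
        h (z.1, y₁) ≤ ((r - α : ℝ) : EReal) ∧ y₁ z.1 ≤ r - α := by
    intro z r hz
    obtain ⟨y₁, y₂, α, hy, hα, hle⟩ := exists_conj_le_of_conj_dualConvolution_le
      (isConvexFn_conj _) hCc hx₀ hf₀ hz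
    have hle' := (hh.le_conj_fitzpatrick _).trans hle
    exact ⟨fst_mem_of_conj_dualConvolution_le hC hCc (interior_subset hx₀) hf₀ hz,
      y₁, y₂, α, hy, hα, hle', by exact_mod_cast (hh.coupling_le _).trans hle'⟩
  have coupling_le : ∀ z : X × WeakDual ℝ X, ((coupling z : ℝ) : EReal) ≤
      conj (dualConvolution (fitzpatrick A) (indicatorSupport C)) z := fun z => by
    refine coe_le_of_forall_real_ge fun r hr => ?_
    obtain ⟨hzC, y₁, y₂, α, hy, hα, -, hle⟩ := split hr
    have := hα _ hzC
    simp only [coupling, ← hy, weakDual_add_apply]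
    linarith
  have hmem : (x₀, y₀) ∈ graph (opAdd A (normalCone C)) :=
    ⟨y₀, hy₀, 0, mem_normalCone.2 ⟨interior_subset hx₀, fun u _ => le_rfl⟩, add_zero _⟩
  refine ⟨⟨⟨_, ne_top_of_le_ne_top (EReal.coe_ne_top _)
    (conj_dualConvolution_le_coupling hmem)⟩, fun z =>
    ne_bot_of_le_ne_bot (EReal.coe_ne_bot _) (coupling_le z)⟩, isConvexFn_conj _,
    lowerSemicontinuous_conj _, coupling_le, fun z => ⟨fun heq => ?_, fun hz =>
      (conj_dualConvolution_le_coupling hz).antisymm (coupling_le z)⟩⟩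
  obtain ⟨hzC, y₁, y₂, α, hy, hα, hle, hle'⟩ := split heq.le
  have hc : coupling z = y₁ z.1 + y₂ z.1 := by simp [coupling, ← hy]
  -- With `r = coupling z`, the bound on `y₁ z.1` gives `α ≤ y₂ z.1`; `hα` gives the reverse.
  have hα' : α = y₂ z.1 := by linarith [hα _ hzC]
  have hy₁ : h (z.1, y₁) = ((coupling (z.1, y₁) : ℝ) : EReal) := by
    refine (hle.trans (le_of_eq ?_)).antisymm (hh.coupling_le _)
    rw [hc, hα', add_sub_cancel_right]
    rfl
  refine ⟨y₁, (hh.eq_iff _).1 hy₁, y₂, mem_normalCone.2 ⟨hzC, fun u hu => ?_⟩, hy⟩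
  rw [map_sub]
  linarith [hα u hu]

end LCSMonotone

theorem theorem4p3 {X : Type*} [AddCommGroup X] [Module ℝ X] [TopologicalSpace X]
    [IsTopologicalAddGroup X] [ContinuousSMul ℝ X] [LocallyConvexSpace ℝ X] [T2Space X]
    (A : X → Set (WeakDual ℝ X)) (hA : LCSMonotone.IsRepresentable A)
    (C : Set X) (hC_closed : IsClosed C) (hC_convex : Convex ℝ C)
    (hAC : (LCSMonotone.domain A ∩ interior C).Nonempty) :
    LCSMonotone.IsRepresentable (LCSMonotone.opAdd A (LCSMonotone.normalCone C)) ∧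
      LCSMonotone.IsRepresentative
        (LCSMonotone.conj
          (LCSMonotone.dualConvolution (LCSMonotone.fitzpatrick A)
            (LCSMonotone.indicatorSupport C)))
        (LCSMonotone.opAdd A (LCSMonotone.normalCone C)) := by
  obtain ⟨-, h, hh⟩ := hA
  obtain ⟨x₀, ⟨y₀, hy₀⟩, hx₀⟩ := hAC
  have hrep := LCSMonotone.isRepresentative_conj_dualConvolution hh hC_closed hC_convex hy₀ hx₀
  exact ⟨⟨⟨x₀, y₀, y₀, hy₀, 0, LCSMonotone.mem_normalCone.2
    ⟨interior_subset hx₀, fun u _ => le_rfl⟩, add_zero _⟩, _, hrep⟩, hrep⟩
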